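/- Let $\Omega\subset\mathbb{R}^d$ ($d\ge 1$) be a nonempty bounded open set (for instance a polygonal or polyhedral domain in $\mathbb{R}^2$ or $\mathbb{R}^3$), let $\kappa\in L^\infty(\Omega)$ with $\kappa\ge c_0>0$ a.e. in $\Omega$, and put \[ a(v,w)=\int_\Omega \kappa\,\nabla v\cdot\nabla w \quad (v,w\in H^1_0(\Omega)),\qquad m(v,w)=\int_\Omega \kappa\, v\,w \quad (v,w\in L^2(\Omega)). \] Let $\mu_1\le\mu_2\le\dots$ be all the eigenvalues, repeated according to multiplicity, of the problem: find $\phi\in H_0^1(\Omega)\setminus\{0\}$ and $\mu\in\mathbb{R}$ with $a(\phi,z)=\mu\, m(\phi,z)$ for all $z\in H^1_0(\Omega)$, and let $\phi_1,\phi_2,\dots\in H^1_0(\Omega)$ be corresponding $m$-orthonormal eigenfunctions. For $v\in L^2(\Omega)$ and $s>0$ let \[ |||v|||_{s;\Omega}^2=\sum_{\ell=1}^\infty \mu_\ell^{s}\, m(v,\phi_\ell)^2\in[0,\infty]. \] Let $u\in L^2(\Omega)$ satisfy $|||u|||_{2;\Omega}<\infty$. Then the series \[ \mathcal{A}u=\sum_{\ell=1}^\infty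 \mu_\ell\, m(u,\phi_\ell)\,\phi_\ell \] converges in $L^2(\Omega)$; $u$ belongs to $H^1_0(\Omega)$; the vector field $\kappa\nabla u$ has a weak divergence $\operatorname{div}(\kappa\nabla u)$ which is a locally integrable function on $\Omega$, $\kappa^{-1}\operatorname{div}(\kappa\nabla u)\in L^2(\Omega)$, and \[ \mathcal{A}u=-\kappa^{-1}\operatorname{div}(\kappa\nabla u)\quad\text{a.e. in }\Omega . \] Moreover, with $\|v\|_0^2=m(v,v)$, \[ |||u|||_{2;\Omega}^2=\|\mathcal{A}u\|_0^2=\int_\Omega \kappa^{-1}\,|\operatorname{div}(\kappa\nabla u)|^2 . \] -/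

import Mathlib

open MeasureTheory Filter Topology
open scoped ENNReal ContDiff

noncomputable section

namespace WeightedDirichlet

variable {d : ℕ} {Ω : Set (EuclideanSpace ℝ (Fin d))}

/-- The space `L²(Ω)` of real functions. -/
abbrev L2 (Ω : Set (EuclideanSpace ℝ (Fin d))) : Type :=
  Lp ℝ 2 (volume.restrict Ω)

/-- The space `L²(Ω; ℝᵈ)` of vector fields. -/
abbrev L2Vec (Ω : Set (EuclideanSpace ℝ (Fin d))) : Type :=
  Lp (EuclideanSpace ℝ (Fin d)) 2 (volume.restrict Ω)

/-- `ψ ∈ C_c^∞(Ω)`. -/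
structure IsTestFunction (Ω : Set (EuclideanSpace ℝ (Fin d)))
    (ψ : EuclideanSpace ℝ (Fin d) → ℝ) : Prop where
  smooth : ContDiff ℝ ∞ ψ
  compact : HasCompactSupport ψ
  support_subset : tsupport ψ ⊆ Ω

/-- `G` is the weak gradient of `u` in `Ω`: `∫_Ω u ∇ψ = - ∫_Ω ψ G` for all test functions. -/
def HasWeakGradient (u : L2 Ω) (G : L2Vec Ω) : Prop :=
  ∀ ψ : EuclideanSpace ℝ (Fin d) → ℝ, IsTestFunction Ω ψ →
    ∫ x in Ω, u x • gradient ψ x = -∫ x in Ω, ψ x • G x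

/-- The Sobolev space `H¹(Ω)`, as a set of elements of `L²(Ω)`. -/
def H1 (Ω : Set (EuclideanSpace ℝ (Fin d))) : Set (L2 Ω) :=
  {u | ∃ G : L2Vec Ω, HasWeakGradient u G}

open Classical in
/-- The weak gradient `∇u` of `u ∈ H¹(Ω)` (and `0` for other `u`). -/
def weakGradient (u : L2 Ω) : L2Vec Ω :=
  if h : ∃ G : L2Vec Ω, HasWeakGradient u G then h.choose else 0

/-- The pairs `(ψ, ∇ψ)` with `ψ ∈ C_c^∞(Ω)`, as elements of `L²(Ω) × L²(Ω; ℝᵈ)`. -/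
def testPairs (Ω : Set (EuclideanSpace ℝ (Fin d))) : Set (L2 Ω × L2Vec Ω) :=
  {p | ∃ ψ : EuclideanSpace ℝ (Fin d) → ℝ, IsTestFunction Ω ψ ∧
    p.1 =ᵐ[volume.restrict Ω] ψ ∧ p.2 =ᵐ[volume.restrict Ω] gradient ψ}

/-- `H¹₀(Ω)`: the closure of `C_c^∞(Ω)` in `H¹(Ω)`. -/
def H10 (Ω : Set (EuclideanSpace ℝ (Fin d))) : Set (L2 Ω) :=
  {u | u ∈ H1 Ω ∧ (u, weakGradient u) ∈ closure (testPairs Ω)}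

/-- `g` is the weak divergence of the vector field `F` in `Ω`. -/
structure HasWeakDivergence (Ω : Set (EuclideanSpace ℝ (Fin d)))
    (F : EuclideanSpace ℝ (Fin d) → EuclideanSpace ℝ (Fin d))
    (g : EuclideanSpace ℝ (Fin d) → ℝ) : Prop where
  locallyIntegrable_field : LocallyIntegrableOn F Ω volume
  locallyIntegrable_div : LocallyIntegrableOn g Ω volume
  integral_eq : ∀ ψ : EuclideanSpace ℝ (Fin d) → ℝ, IsTestFunction Ω ψ →
    ∫ x in Ω, g x * ψ x = -∫ x in Ω, inner ℝ (F x) (gradient ψ x)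

/-- The mass form `m(v, w) = ∫_Ω κ v w`. -/
def massForm (κ : EuclideanSpace ℝ (Fin d) → ℝ) (v w : L2 Ω) : ℝ :=
  ∫ x in Ω, κ x * v x * w x

/-- The energy form `a(v, w) = ∫_Ω κ ∇v · ∇w`. -/
def energyForm (κ : EuclideanSpace ℝ (Fin d) → ℝ) (v w : L2 Ω) : ℝ :=
  ∫ x in Ω, κ x * inner ℝ (weakGradient v x) (weakGradient w x)

/-- `w` is a weak solution in `H¹₀(Ω)` of `-div(κ∇w) = ν κ w`
(an eigenfunction for `ν`, or zero). -/
def SolvesEigenproblem (κ : EuclideanSpace ℝ (Fin d) → ℝ) (ν : ℝ) (w : L2 Ω) : Prop :=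
  w ∈ H10 Ω ∧ ∀ z ∈ H10 Ω, energyForm κ w z = ν * massForm κ w z

/-- `μ 0 ≤ μ 1 ≤ …` lists all Dirichlet eigenvalues, repeated according to multiplicity, and
`φ 0, φ 1, …` are corresponding `m`-orthonormal eigenfunctions: the last clause says that
no eigenfunction is missing (completeness of `φ` in `L²(Ω)` is not part of the definition). -/
structure IsDirichletEigensystem (κ : EuclideanSpace ℝ (Fin d) → ℝ)
    (μ : ℕ → ℝ) (φ : ℕ → L2 Ω) : Prop where
  monotone : Monotone μ
  eigen : ∀ l, SolvesEigenproblem κ (μ l) (φ l)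
  orthonormal : ∀ k l, massForm κ (φ k) (φ l) = if k = l then 1 else 0
  exhaustive : ∀ (ν : ℝ) (w : L2 Ω), SolvesEigenproblem κ ν w →
    w ∈ Submodule.span ℝ (φ '' {l | μ l = ν})

/-- `|||v|||_{s;Ω} = (∑ₗ μₗ ^ s m(v, φₗ)²) ^ (1/2)`, a number in `[0, ∞]`. -/
def eigenNorm (κ : EuclideanSpace ℝ (Fin d) → ℝ) (μ : ℕ → ℝ) (φ : ℕ → L2 Ω)
    (s : ℝ) (v : L2 Ω) : ℝ≥0∞ :=
  (∑' l, ENNReal.ofReal (μ l ^ s * massForm κ v (φ l) ^ 2)) ^ (1 / 2 : ℝ)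

/-- `𝒜v = ∑ₗ μₗ m(v, φₗ) φₗ`, the series being taken in `L²(Ω)`. -/
def eigenOperator (κ : EuclideanSpace ℝ (Fin d) → ℝ) (μ : ℕ → ℝ) (φ : ℕ → L2 Ω)
    (v : L2 Ω) : L2 Ω :=
  ∑' l, (μ l * massForm κ v (φ l)) • φ l

end WeightedDirichlet

end

open WeightedDirichlet

/-!
Multiplication by `√κ` is an isomorphism of `L²(Ω)` which turns the mass form `m` into the ordinary
inner product, and `u ↦ (√κ u, √κ ∇u)` identifies `H¹₀(Ω)`, with the inner product `m + a`, with a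
closed subspace of `L²(Ω) ⊕ L²(Ω; ℝᵈ)`, the energy space (`IsWeight.energySpace`). Let `J` be the
embedding of the energy space in `L²(Ω)`.

The main point is that the functions `√κ φₗ` are complete in `L²(Ω)`
(`IsDirichletEigensystem.orthogonal_span_mulSqrt_eq_bot`). By Rellich's theorem `J` is compact, so
the spectral theorem applies to `J J*`. Its eigenvectors with nonzero eigenvalues come from
solutions of the Dirichlet eigenvalue problem, hence from the `φₗ`, and its kernel is zero because
test functions are dense. Rellich's theorem (`isCompactOperator_fst_of_mem_testClosure`) is proved by
approximating a test function by a function that is constant on each cube of a grid of mesh `ε`: the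
translation estimate `‖ψ(· + h) - ψ‖ ≤ |h| ‖∇ψ‖` bounds the error by a multiple of `ε ‖∇ψ‖`
(`exists_gridIndex_approx`), so that `J` is a norm limit of operators of finite rank.

Given completeness, `|||u|||₂ < ∞` says that the coefficients `μₗ m(u, φₗ)` are square-summable, so
`f = 𝒜u` exists by the Riesz-Fischer theorem, with Parseval's identity for its norm. The weak
solution `w ∈ H¹₀(Ω)` of `-div(κ∇w) + κ w = κ (f + u)`, tested with `φₗ`, has the same coefficients
as `u`, hence `w = u` and `a(u, z) = m(f, z)` for all `z ∈ H¹₀(Ω)`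
(`IsDirichletEigensystem.mem_H10_and_energyForm_eq`). For test functions `z` this is the statement
`div(κ∇u) = -κ f`.
-/

noncomputable section

namespace WeightedDirichlet

variable {d : ℕ} {Ω : Set (EuclideanSpace ℝ (Fin d))}

/-! ### Test functions and weak gradients -/

namespace IsTestFunction

variable {ψ η : EuclideanSpace ℝ (Fin d) → ℝ}

lemma contDiff_gradient (h : IsTestFunction Ω ψ) : ContDiff ℝ ∞ (gradient ψ) :=
  (InnerProductSpace.toDual ℝ (EuclideanSpace ℝ (Fin d))).symm.toContinuousLinearEquiv.contDiff.comp
    (h.smooth.fderiv_right (m := ∞) le_rfl)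

lemma differentiable (h : IsTestFunction Ω ψ) : Differentiable ℝ ψ :=
  h.smooth.differentiable (by simp)

lemma hasCompactSupport_gradient (h : IsTestFunction Ω ψ) : HasCompactSupport (gradient ψ) :=
  (h.compact.fderiv (𝕜 := ℝ)).comp_left (map_zero _)

lemma memLp (h : IsTestFunction Ω ψ) (p : ℝ≥0∞) : MemLp ψ p (volume.restrict Ω) :=
  (h.smooth.continuous.memLp_of_hasCompactSupport h.compact).restrict Ω

lemma memLp_gradient (h : IsTestFunction Ω ψ) (p : ℝ≥0∞) :
    MemLp (gradient ψ) p (volume.restrict Ω) :=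
  (h.contDiff_gradient.continuous.memLp_of_hasCompactSupport
    h.hasCompactSupport_gradient).restrict Ω

lemma eq_zero_of_notMem (h : IsTestFunction Ω ψ) {x} (hx : x ∉ Ω) : ψ x = 0 :=
  image_eq_zero_of_notMem_tsupport fun hx' => hx (h.support_subset hx')

lemma gradient_eq_zero_of_notMem (h : IsTestFunction Ω ψ) {x} (hx : x ∉ Ω) :
    gradient ψ x = 0 := by
  have : fderiv ℝ ψ x = 0 := image_eq_zero_of_notMem_tsupport fun hx' =>
    hx (h.support_subset (tsupport_fderiv_subset ℝ hx'))
  simp [gradient, this]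

lemma gradient_add (hψ : IsTestFunction Ω ψ) (hη : IsTestFunction Ω η) (x) :
    gradient (ψ + η) x = gradient ψ x + gradient η x := by
  simp [gradient, fderiv_add (hψ.differentiable x) (hη.differentiable x)]

lemma gradient_smul (hψ : IsTestFunction Ω ψ) (c : ℝ) (x) :
    gradient (c • ψ) x = c • gradient ψ x := by
  simp [gradient, fderiv_const_smul (hψ.differentiable x) c]

lemma add (hψ : IsTestFunction Ω ψ) (hη : IsTestFunction Ω η) : IsTestFunction Ω (ψ + η) where
  smooth := hψ.smooth.add hη.smooth
  compact := hψ.compact.add hη.compact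
  support_subset := (tsupport_add ψ η).trans (Set.union_subset hψ.support_subset hη.support_subset)

lemma smul (hψ : IsTestFunction Ω ψ) (c : ℝ) : IsTestFunction Ω (c • ψ) where
  smooth := contDiff_const.smul hψ.smooth
  compact := hψ.compact.smul_left
  support_subset := (closure_mono (Function.support_const_smul_subset c ψ)).trans hψ.support_subset

lemma zero : IsTestFunction Ω (0 : EuclideanSpace ℝ (Fin d) → ℝ) where
  smooth := contDiff_const
  compact := HasCompactSupport.zero
  support_subset := by simp [tsupport]

lemma integral_smul_gradient (hψ : IsTestFunction Ω ψ) (hη : IsTestFunction Ω η) :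
    ∫ x in Ω, η x • gradient ψ x = -∫ x in Ω, ψ x • gradient η x := by
  have key {ψ η : EuclideanSpace ℝ (Fin d) → ℝ} (hψ : IsTestFunction Ω ψ)
      (hη : IsTestFunction Ω η) : Integrable (fun x => η x • gradient ψ x) :=
    (hη.smooth.continuous.smul hψ.contDiff_gradient.continuous).integrable_of_hasCompactSupport
      hη.compact.smul_right
  rw [setIntegral_eq_integral_of_forall_compl_eq_zero
      (fun x hx => by simp [hη.eq_zero_of_notMem hx]),
    setIntegral_eq_integral_of_forall_compl_eq_zero
      (fun x hx => by simp [hψ.eq_zero_of_notMem hx])]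
  refine ext_inner_left ℝ fun v => ?_
  rw [inner_neg_right, ← integral_inner (key hψ hη), ← integral_inner (key hη hψ)]
  simp only [inner_smul_right, inner_gradient_right, conj_trivial]
  rw [integral_mul_fderiv_eq_neg_fderiv_mul_of_integrable _ _ _
    (fun x _ => hη.differentiable x) (fun x _ => hψ.differentiable x)]
  · simp only [mul_comm]
  · simpa only [inner_smul_right, inner_gradient_right, conj_trivial, mul_comm]
      using (key hη hψ).const_inner (𝕜 := ℝ) v
  · simpa only [inner_smul_right, inner_gradient_right, conj_trivial]
      using (key hψ hη).const_inner (𝕜 := ℝ) v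
  · exact (hη.smooth.continuous.mul hψ.smooth.continuous).integrable_of_hasCompactSupport
      hη.compact.mul_right

end IsTestFunction

/-- A weak gradient is unique, by the fundamental lemma of the calculus of variations. -/
lemma HasWeakGradient.unique (hΩ : IsOpen Ω) {u : L2 Ω} {G G' : L2Vec Ω}
    (h : HasWeakGradient u G) (h' : HasWeakGradient u G') : G = G' := by
  have hint (H : L2Vec Ω) {ψ} (hψ : IsTestFunction Ω ψ) :
      Integrable (fun x => ψ x • H x) (volume.restrict Ω) :=
    memLp_one_iff_integrable.1 ((Lp.memLp H).smul (hψ.memLp 2))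
  have : ∀ᵐ x, x ∈ Ω → (G - G' : L2Vec Ω) x = 0 := by
    refine hΩ.ae_eq_zero_of_integral_contDiff_smul_eq_zero ?_ fun ψ h1 h2 h3 => ?_
    · exact locallyIntegrableOn_of_locallyIntegrable_restrict
        ((Lp.memLp (G - G')).locallyIntegrable (by norm_num))
    · have hψ : IsTestFunction Ω ψ := ⟨h1, h2, h3⟩
      have e := (h ψ hψ).symm.trans (h' ψ hψ)
      rw [neg_inj, ← sub_eq_zero, ← integral_sub (hint G hψ) (hint G' hψ)] at e
      rw [← setIntegral_eq_integral_of_forall_compl_eq_zero (s := Ω)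
        (fun x hx => by simp [hψ.eq_zero_of_notMem hx]), ← e]
      refine integral_congr_ae ?_
      filter_upwards [Lp.coeFn_sub G G'] with x hx
      rw [hx, Pi.sub_apply, smul_sub]
  rw [← ae_restrict_iff' hΩ.measurableSet] at this
  rw [← sub_eq_zero]
  exact Lp.ext (EventuallyEq.trans this (Lp.coeFn_zero _ _ _).symm)

/-- Weak gradients form a closed relation in `L²(Ω) × L²(Ω; ℝᵈ)`: both sides of the defining
identity are continuous in `u` and `G`. -/
lemma isClosed_setOf_hasWeakGradient : IsClosed {p : L2 Ω × L2Vec Ω | HasWeakGradient p.1 p.2} := by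
  simp only [HasWeakGradient, Set.ofPred_forall]
  refine isClosed_iInter fun ψ => isClosed_iInter fun hψ => ?_
  let B : ℝ →L[ℝ] EuclideanSpace ℝ (Fin d) →L[ℝ] EuclideanSpace ℝ (Fin d) :=
    ContinuousLinearMap.lsmul ℝ ℝ
  let g : L2Vec Ω := (hψ.memLp_gradient 2).toLp
  let f : L2 Ω := (hψ.memLp 2).toLp
  have h1 (u : L2 Ω) : ∫ x in Ω, u x • gradient ψ x = B.lpPairing (volume.restrict Ω) 2 2 u g := by
    rw [ContinuousLinearMap.lpPairing_eq_integral]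
    refine integral_congr_ae ?_
    filter_upwards [(hψ.memLp_gradient 2).coeFn_toLp] with x hx
    simp [B, g, hx]
  have h2 (G : L2Vec Ω) : ∫ x in Ω, ψ x • G x = B.lpPairing (volume.restrict Ω) 2 2 f G := by
    rw [ContinuousLinearMap.lpPairing_eq_integral]
    refine integral_congr_ae ?_
    filter_upwards [(hψ.memLp 2).coeFn_toLp] with x hx
    simp [B, f, hx]
  simp only [h1, h2]
  exact isClosed_eq (by fun_prop) (by fun_prop)

lemma hasWeakGradient_of_mem_testPairs {p : L2 Ω × L2Vec Ω} (hp : p ∈ testPairs Ω) :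
    HasWeakGradient p.1 p.2 := by
  obtain ⟨η, hη, h1, h2⟩ := hp
  intro ψ hψ
  rw [integral_congr_ae (g := fun x => η x • gradient ψ x),
    hψ.integral_smul_gradient hη, integral_congr_ae (f := fun x => ψ x • p.2 x)
      (g := fun x => ψ x • gradient η x)]
  · filter_upwards [h2] with x hx
    rw [hx]
  · filter_upwards [h1] with x hx
    rw [hx]

lemma hasWeakGradient_of_mem_closure {u : L2 Ω} {G : L2Vec Ω}
    (h : (u, G) ∈ closure (testPairs Ω)) : HasWeakGradient u G :=
  closure_minimal (fun _ => hasWeakGradient_of_mem_testPairs) isClosed_setOf_hasWeakGradient h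

lemma HasWeakGradient.weakGradient_eq (hΩ : IsOpen Ω) {u : L2 Ω} {G : L2Vec Ω}
    (h : HasWeakGradient u G) : weakGradient u = G := by
  have hex : ∃ G, HasWeakGradient u G := ⟨G, h⟩
  rw [weakGradient, dif_pos hex]
  exact hex.choose_spec.unique hΩ h

/-- The graph of the weak gradient on `H¹₀(Ω)`, as a closed subspace of `L²(Ω) × L²(Ω; ℝᵈ)`. It is
defined as the closure of the pairs `(ψ, ∇ψ)` with `ψ` a test function. -/
def testClosure (Ω : Set (EuclideanSpace ℝ (Fin d))) : Submodule ℝ (L2 Ω × L2Vec Ω) :=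
  Submodule.topologicalClosure
    { carrier := testPairs Ω
      zero_mem' := ⟨0, .zero, Lp.coeFn_zero _ _ _, by
        filter_upwards [Lp.coeFn_zero (EuclideanSpace ℝ (Fin d)) 2 (volume.restrict Ω)] with x hx
        simpa [gradient] using hx⟩
      add_mem' := by
        rintro p q ⟨ψ, hψ, h1, h2⟩ ⟨η, hη, h3, h4⟩
        refine ⟨ψ + η, hψ.add hη, ?_, ?_⟩
        · filter_upwards [Lp.coeFn_add p.1 q.1, h1, h3] with x hx h1 h3
          rw [Prod.fst_add, hx, Pi.add_apply, h1, h3, Pi.add_apply]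
        · filter_upwards [Lp.coeFn_add p.2 q.2, h2, h4] with x hx h1 h3
          rw [Prod.snd_add, hx, Pi.add_apply, h1, h3, hψ.gradient_add hη]
      smul_mem' := by
        rintro c p ⟨ψ, hψ, h1, h2⟩
        refine ⟨c • ψ, hψ.smul c, ?_, ?_⟩
        · filter_upwards [Lp.coeFn_smul c p.1, h1] with x hx h1
          simp [hx, h1]
        · filter_upwards [Lp.coeFn_smul c p.2, h2] with x hx h1
          simp [hx, h1, hψ.gradient_smul] }

lemma weakGradient_eq_of_mem (hΩ : IsOpen Ω) {p : L2 Ω × L2Vec Ω} (h : p ∈ testClosure Ω) :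
    weakGradient p.1 = p.2 :=
  (hasWeakGradient_of_mem_closure h).weakGradient_eq hΩ

lemma mem_H10_of_mem (hΩ : IsOpen Ω) {p : L2 Ω × L2Vec Ω} (h : p ∈ testClosure Ω) :
    p.1 ∈ H10 Ω :=
  ⟨⟨_, hasWeakGradient_of_mem_closure h⟩, by rw [weakGradient_eq_of_mem hΩ h]; exact h⟩

lemma IsTestFunction.toLp_mem {ψ : EuclideanSpace ℝ (Fin d) → ℝ} (h : IsTestFunction Ω ψ) :
    ((h.memLp 2).toLp ψ, (h.memLp_gradient 2).toLp (gradient ψ)) ∈ testClosure Ω :=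
  subset_closure ⟨ψ, h, MemLp.coeFn_toLp (h.memLp 2), MemLp.coeFn_toLp (h.memLp_gradient 2)⟩

/-! ### Compactness of the embedding of `H¹₀(Ω)` in `L²(Ω)` -/

lemma sq_lintegral_le_lintegral_sq {α : Type*} {m : MeasurableSpace α} {ν : Measure α}
    [IsProbabilityMeasure ν] {f : α → ℝ≥0∞} (hf : AEMeasurable f ν) :
    (∫⁻ x, f x ∂ν) ^ 2 ≤ ∫⁻ x, f x ^ 2 ∂ν := by
  have h := ENNReal.lintegral_mul_le_Lp_mul_Lq ν Real.HolderConjugate.two_two hf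
    (aemeasurable_const (b := (1 : ℝ≥0∞)))
  simp only [Pi.mul_apply, mul_one, ENNReal.one_rpow, lintegral_const, measure_univ,
    ENNReal.rpow_two, one_pow] at h
  calc (∫⁻ x, f x ∂ν) ^ 2 ≤ ((∫⁻ x, f x ^ 2 ∂ν) ^ (1 / 2 : ℝ)) ^ 2 := by gcongr
    _ = ∫⁻ x, f x ^ 2 ∂ν := by
      rw [← ENNReal.rpow_two, ← ENNReal.rpow_mul]
      norm_num

/-- The translation estimate `‖ψ(· + h) - ψ‖_{L²} ≤ |h| ‖∇ψ‖_{L²}`. -/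
lemma lintegral_translate_sub_sq_le {ψ : EuclideanSpace ℝ (Fin d) → ℝ} (hψ : ContDiff ℝ ∞ ψ)
    (h : EuclideanSpace ℝ (Fin d)) :
    ∫⁻ x, ‖ψ (x + h) - ψ x‖ₑ ^ 2 ≤ ‖h‖ₑ ^ 2 * ∫⁻ x, ‖gradient ψ x‖ₑ ^ 2 := by
  have hd : Differentiable ℝ ψ := hψ.differentiable (by simp)
  have hc : Continuous (fderiv ℝ ψ) := hψ.continuous_fderiv (by simp)
  have hnorm (x) : ‖gradient ψ x‖ₑ = ‖fderiv ℝ ψ x‖ₑ := by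
    rw [gradient, LinearIsometryEquiv.enorm_map]
  have hcont : Continuous fun z : EuclideanSpace ℝ (Fin d) × ℝ =>
      ‖fderiv ℝ ψ (z.1 + z.2 • h)‖ₑ ^ 2 := by fun_prop
  have hprob : IsProbabilityMeasure (volume.restrict (Set.Ioc (0 : ℝ) 1)) := ⟨by simp⟩
  have hpt (x) : ‖ψ (x + h) - ψ x‖ₑ ^ 2 ≤
      ‖h‖ₑ ^ 2 * ∫⁻ t in Set.Ioc (0 : ℝ) 1, ‖fderiv ℝ ψ (x + t • h)‖ₑ ^ 2 := by
    have hline (t : ℝ) : HasDerivAt (fun t : ℝ => ψ (x + t • h)) (fderiv ℝ ψ (x + t • h) h) t := by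
      have h2 : HasDerivAt (fun t : ℝ => x + t • h) h t := by
        simpa using ((hasDerivAt_id t).smul_const h).const_add x
      exact (hd (x + t • h)).hasFDerivAt.comp_hasDerivAt t h2
    have hftc := intervalIntegral.integral_eq_sub_of_hasDerivAt (a := 0) (b := 1)
      (fun t _ => hline t) (Continuous.intervalIntegrable (by fun_prop) _ _)
    rw [one_smul, zero_smul, add_zero, intervalIntegral.integral_of_le zero_le_one] at hftc
    rw [← hftc]
    calc ‖∫ t in Set.Ioc (0 : ℝ) 1, fderiv ℝ ψ (x + t • h) h‖ₑ ^ 2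
        ≤ (∫⁻ t in Set.Ioc (0 : ℝ) 1, ‖fderiv ℝ ψ (x + t • h)‖ₑ * ‖h‖ₑ) ^ 2 := by
          gcongr
          refine (enorm_integral_le_lintegral_enorm _).trans (lintegral_mono fun t => ?_)
          exact ContinuousLinearMap.le_opENorm _ _
      _ = ‖h‖ₑ ^ 2 * (∫⁻ t in Set.Ioc (0 : ℝ) 1, ‖fderiv ℝ ψ (x + t • h)‖ₑ) ^ 2 := by
          rw [lintegral_mul_const' _ _ enorm_ne_top, mul_pow, mul_comm]
      _ ≤ _ := by
          gcongr
          exact sq_lintegral_le_lintegral_sq (Continuous.aemeasurable (by fun_prop))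
  calc ∫⁻ x, ‖ψ (x + h) - ψ x‖ₑ ^ 2
      ≤ ∫⁻ x, ‖h‖ₑ ^ 2 * ∫⁻ t in Set.Ioc (0 : ℝ) 1, ‖fderiv ℝ ψ (x + t • h)‖ₑ ^ 2 :=
        lintegral_mono hpt
    _ = ‖h‖ₑ ^ 2 * ∫⁻ t in Set.Ioc (0 : ℝ) 1, ∫⁻ x, ‖fderiv ℝ ψ (x + t • h)‖ₑ ^ 2 := by
        rw [lintegral_const_mul' _ _ (by simp), lintegral_lintegral_swap hcont.aemeasurable]
    _ = ‖h‖ₑ ^ 2 * ∫⁻ x, ‖gradient ψ x‖ₑ ^ 2 := by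
        simp only [lintegral_add_right_eq_self (fun x => ‖fderiv ℝ ψ x‖ₑ ^ 2), lintegral_const,
          measure_univ, mul_one, hnorm]

/-- The multi-index of the cell containing `x` in the grid of half-open cubes of side `ε`. -/
def gridIndex (ε : ℝ) (x : EuclideanSpace ℝ (Fin d)) : Fin d → ℤ := fun i => ⌊x i / ε⌋

lemma measurable_gridIndex (ε : ℝ) : Measurable (gridIndex (d := d) ε) :=
  measurable_pi_lambda _ fun i => Int.measurable_floor.comp (by fun_prop)

lemma volume_gridIndex_preimage {ε : ℝ} (hε : 0 < ε) (k : Fin d → ℤ) :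
    volume (gridIndex ε ⁻¹' {k}) = ENNReal.ofReal ε ^ d := by
  have : gridIndex ε ⁻¹' {k} = WithLp.ofLp ⁻¹'
      (Set.univ.pi fun i => Set.Ico (k i * ε) ((k i + 1) * ε)) := by
    ext x
    simp only [gridIndex, Set.mem_preimage, Set.mem_singleton_iff, funext_iff, Int.floor_eq_iff,
      Set.mem_univ_pi, Set.mem_Ico, le_div_iff₀ hε, div_lt_iff₀ hε]
  rw [this, (PiLp.volume_preserving_ofLp (Fin d)).measure_preimage
    (MeasurableSet.univ_pi fun i => measurableSet_Ico).nullMeasurableSet, Real.volume_pi_Ico]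
  simp [add_mul]

/-- The cube `[-ε, ε]ᵈ`, which contains all differences of points of a common grid cell. -/
def gridBox (d : ℕ) (ε : ℝ) : Set (EuclideanSpace ℝ (Fin d)) :=
  WithLp.ofLp ⁻¹' (Set.univ.pi fun _ => Set.Icc (-ε) ε)

lemma measurableSet_gridBox (ε : ℝ) : MeasurableSet (gridBox d ε) :=
  (PiLp.volume_preserving_ofLp (Fin d)).measurable
    (MeasurableSet.univ_pi fun _ => measurableSet_Icc)

lemma volume_gridBox (ε : ℝ) : volume (gridBox d ε) = ENNReal.ofReal (2 * ε) ^ d := by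
  rw [gridBox, (PiLp.volume_preserving_ofLp (Fin d)).measure_preimage
    (MeasurableSet.univ_pi fun i => measurableSet_Icc).nullMeasurableSet,
    Set.pi_univ_Icc (fun _ => -ε) (fun _ => ε),
    Real.volume_Icc_pi]
  simp [two_mul]

lemma enorm_sq_le_of_mem_gridBox {ε : ℝ} {h : EuclideanSpace ℝ (Fin d)} (hh : h ∈ gridBox d ε) :
    ‖h‖ₑ ^ 2 ≤ ENNReal.ofReal (d * ε ^ 2) := by
  rw [← ofReal_norm, ← ENNReal.ofReal_pow (norm_nonneg _), EuclideanSpace.real_norm_sq_eq]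
  refine ENNReal.ofReal_le_ofReal ?_
  calc ∑ i, h i ^ 2 ≤ ∑ _i : Fin d, ε ^ 2 := by
        refine Finset.sum_le_sum fun i _ => ?_
        have := hh i (Set.mem_univ i)
        exact sq_le_sq' this.1 this.2
    _ = d * ε ^ 2 := by simp

lemma sub_mem_gridBox {ε : ℝ} (hε : 0 < ε) {x y : EuclideanSpace ℝ (Fin d)}
    (h : gridIndex ε x = gridIndex ε y) : x - y ∈ gridBox d ε := by
  intro i _
  have := Int.abs_sub_lt_one_of_floor_eq_floor (congrFun h i)
  rw [← sub_div, abs_div, abs_of_pos hε, div_lt_one hε] at this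
  exact abs_le.1 this.le

/-- Approximation of a smooth function by a function that is constant on each cell of the grid of
mesh `ε`, with an `L²` error at most `√(2ᵈ d) ε ‖∇ψ‖`. The value in each cell is a value of `ψ` at
which the mean square deviation is not larger than average; summed over the cells, the averages
are controlled by the translation estimate for all `h ∈ [-ε, ε]ᵈ`. -/
lemma exists_gridIndex_approx {ψ : EuclideanSpace ℝ (Fin d) → ℝ} (hψ : ContDiff ℝ ∞ ψ)
    {ε : ℝ} (hε : 0 < ε) :
    ∃ c : (Fin d → ℤ) → ℝ, ∫⁻ x, ‖ψ x - c (gridIndex ε x)‖ₑ ^ 2 ≤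
      ENNReal.ofReal (2 ^ d * (d * ε ^ 2)) * ∫⁻ x, ‖gradient ψ x‖ₑ ^ 2 := by
  set Q : (Fin d → ℤ) → Set (EuclideanSpace ℝ (Fin d)) := fun k => gridIndex ε ⁻¹' {k} with hQ
  have hQm (k) : MeasurableSet (Q k) := measurable_gridIndex ε (measurableSet_singleton k)
  have hQv (k) : volume (Q k) = ENNReal.ofReal ε ^ d := volume_gridIndex_preimage hε k
  have hv0 : ENNReal.ofReal ε ^ d ≠ 0 := by simp [hε]
  have hvt : ENNReal.ofReal ε ^ d ≠ ⊤ := by simp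
  have hsum (f : EuclideanSpace ℝ (Fin d) → ℝ≥0∞) : ∑' k, ∫⁻ x in Q k, f x = ∫⁻ x, f x := by
    rw [← lintegral_iUnion hQm, hQ, ← Set.preimage_iUnion, Set.iUnion_of_singleton,
      Set.preimage_univ, setLIntegral_univ]
    exact fun i j hij => Disjoint.preimage _ (by simpa using hij)
  have hψc := hψ.continuous
  have hc (k) : ∃ y, ∫⁻ x in Q k, ‖ψ x - ψ y‖ₑ ^ 2 ≤
      (ENNReal.ofReal ε ^ d)⁻¹ * ∫⁻ y in Q k, ∫⁻ x in Q k, ‖ψ x - ψ y‖ₑ ^ 2 := by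
    obtain ⟨y, -, hy⟩ := exists_le_setLAverage (μ := volume) (s := Q k)
      (f := fun y => ∫⁻ x in Q k, ‖ψ x - ψ y‖ₑ ^ 2) (by rwa [hQv]) (by rwa [hQv])
      (Measurable.lintegral_prod_right' (f := fun z : EuclideanSpace ℝ (Fin d) ×
        EuclideanSpace ℝ (Fin d) => ‖ψ z.2 - ψ z.1‖ₑ ^ 2)
          (Continuous.measurable (by fun_prop))).aemeasurable
    refine ⟨y, hy.trans_eq ?_⟩
    rw [setLAverage_eq, hQv, ENNReal.div_eq_inv_mul]
  choose y hy using hc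
  refine ⟨fun k => ψ (y k), ?_⟩
  have hbox (k) {y} (hyk : y ∈ Q k) : ∫⁻ x in Q k, ‖ψ x - ψ y‖ₑ ^ 2 ≤
      ∫⁻ h in gridBox d ε, ‖ψ (y + h) - ψ y‖ₑ ^ 2 := by
    rw [← lintegral_indicator (hQm k), ← lintegral_indicator (measurableSet_gridBox ε),
      ← lintegral_add_left_eq_self _ y]
    refine lintegral_mono fun h => ?_
    by_cases hh : y + h ∈ Q k
    · have : h ∈ gridBox d ε := by
        simpa using sub_mem_gridBox hε ((hh : gridIndex ε (y + h) = k).trans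
          (hyk : gridIndex ε y = k).symm)
      simp [hh, this]
    · simp [hh]
  calc ∫⁻ x, ‖ψ x - ψ (y (gridIndex ε x))‖ₑ ^ 2
      = ∑' k, ∫⁻ x in Q k, ‖ψ x - ψ (y k)‖ₑ ^ 2 := by
        rw [← hsum]
        refine tsum_congr fun k => setLIntegral_congr_fun (hQm k) fun x hx => ?_
        rw [show gridIndex ε x = k from hx]
    _ ≤ ∑' k, (ENNReal.ofReal ε ^ d)⁻¹ *
          ∫⁻ y in Q k, ∫⁻ h in gridBox d ε, ‖ψ (y + h) - ψ y‖ₑ ^ 2 := by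
        refine ENNReal.tsum_le_tsum fun k => (hy k).trans ?_
        gcongr 1
        exact setLIntegral_mono' (hQm k) fun y hyk => hbox k hyk
    _ = (ENNReal.ofReal ε ^ d)⁻¹ *
          ∫⁻ h in gridBox d ε, ∫⁻ y, ‖ψ (y + h) - ψ y‖ₑ ^ 2 := by
        rw [ENNReal.tsum_mul_left, hsum, lintegral_lintegral_swap]
        exact Continuous.aemeasurable (by fun_prop)
    _ ≤ (ENNReal.ofReal ε ^ d)⁻¹ * ∫⁻ _h in gridBox d ε,
          ENNReal.ofReal (d * ε ^ 2) * ∫⁻ x, ‖gradient ψ x‖ₑ ^ 2 := by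
        gcongr 1
        refine setLIntegral_mono' (measurableSet_gridBox ε) fun h hh => ?_
        refine (lintegral_translate_sub_sq_le hψ h).trans ?_
        gcongr
        exact enorm_sq_le_of_mem_gridBox hh
    _ = _ := by
        rw [setLIntegral_const, volume_gridBox, ENNReal.ofReal_mul zero_le_two, mul_pow,
          ENNReal.ofReal_mul (by positivity : (0 : ℝ) ≤ 2 ^ d), ENNReal.ofReal_pow zero_le_two]
        calc _ = ((ENNReal.ofReal ε ^ d)⁻¹ * ENNReal.ofReal ε ^ d) *
              (ENNReal.ofReal 2 ^ d * ENNReal.ofReal (d * ε ^ 2) *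
                ∫⁻ x, ‖gradient ψ x‖ₑ ^ 2) := by ring
          _ = _ := by rw [ENNReal.inv_mul_cancel hv0 hvt, one_mul]

lemma finite_image_gridIndex (hΩ : Bornology.IsBounded Ω) {ε : ℝ} (hε : 0 < ε) :
    (gridIndex ε '' Ω).Finite := by
  obtain ⟨R, hR⟩ := hΩ.exists_norm_le
  refine (Set.finite_Icc (fun _ => ⌊-R / ε⌋) (fun _ => ⌊R / ε⌋)).subset ?_
  rintro _ ⟨x, hx, rfl⟩
  have hx' (i) : |x i| ≤ R := (PiLp.norm_apply_le x i).trans (hR x hx)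
  refine ⟨fun i => Int.floor_le_floor ?_, fun i => Int.floor_le_floor ?_⟩
  · gcongr
    exact (abs_le.1 (hx' i)).1
  · gcongr
    exact (abs_le.1 (hx' i)).2

/-- On a bounded set, the functions that are constant on each cell of the grid form a
finite-dimensional subspace of `L²(Ω)`. -/
lemma exists_finiteDimensional_gridIndex (hΩ : IsOpen Ω) (hΩb : Bornology.IsBounded Ω) {ε : ℝ}
    (hε : 0 < ε) : ∃ W : Submodule ℝ (L2 Ω), FiniteDimensional ℝ W ∧
      ∀ c : (Fin d → ℤ) → ℝ, ∃ w ∈ W, w =ᵐ[volume.restrict Ω] fun x => c (gridIndex ε x) := by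
  have hfin := finite_image_gridIndex hΩb hε
  have : Finite (gridIndex ε '' Ω) := hfin
  have : IsFiniteMeasure (volume.restrict Ω) := ⟨by simpa using hΩb.measure_lt_top⟩
  have hmem (c : (Fin d → ℤ) → ℝ) : MemLp (fun x => c (gridIndex ε x)) 2 (volume.restrict Ω) := by
    obtain ⟨C, hC⟩ := (hfin.image fun k => ‖c k‖).bddAbove
    refine MemLp.of_bound
      ((measurable_of_countable c).comp (measurable_gridIndex ε)).aestronglyMeasurable C ?_
    filter_upwards [ae_restrict_mem hΩ.measurableSet] with x hx
    exact hC ⟨_, ⟨x, hx, rfl⟩, rfl⟩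
  let E := Function.ExtendByZero.linearMap ℝ ((↑) : gridIndex ε '' Ω → Fin d → ℤ)
  let T : (gridIndex ε '' Ω → ℝ) →ₗ[ℝ] L2 Ω :=
    { toFun := fun a => (hmem (E a)).toLp
      map_add' := fun a b => by
        rw [← MemLp.toLp_add]
        exact MemLp.toLp_congr _ _ (.of_forall fun x => by simp)
      map_smul' := fun r a => by
        rw [RingHom.id_apply, ← MemLp.toLp_const_smul]
        exact MemLp.toLp_congr _ _ (.of_forall fun x => by simp) }
  refine ⟨T.range, inferInstance, fun c => ⟨T fun k => c k, ⟨_, rfl⟩, ?_⟩⟩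
  filter_upwards [(hmem (E fun k => c k)).coeFn_toLp, ae_restrict_mem hΩ.measurableSet] with x h1 hx
  refine h1.trans ?_
  exact Subtype.val_injective.extend_apply (fun k : gridIndex ε '' Ω => c k) 0
    ⟨gridIndex ε x, x, hx, rfl⟩

lemma eLpNorm_two_sq {α F : Type*} {m : MeasurableSpace α} {ν : Measure α} [NormedAddCommGroup F]
    (f : α → F) : eLpNorm f 2 ν ^ 2 = ∫⁻ x, ‖f x‖ₑ ^ 2 ∂ν := by
  simpa using eLpNorm_nnreal_pow_eq_lintegral (f := f) (μ := ν) (p := 2) two_ne_zero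

/-- Elements of `H¹₀(Ω)` are approximated in `L²(Ω)` by a finite-dimensional subspace, uniformly in
terms of the norm of the gradient. -/
lemma exists_finiteDimensional_approx (hΩ : IsOpen Ω) (hΩb : Bornology.IsBounded Ω) {δ : ℝ}
    (hδ : 0 < δ) : ∃ (W : Submodule ℝ (L2 Ω)) (_ : FiniteDimensional ℝ W),
      ∀ p ∈ testClosure Ω, ‖p.1 - W.starProjection p.1‖ ≤ δ * ‖p.2‖ := by
  set ε : ℝ := δ / √(2 ^ d * d + 1)
  have hε : 0 < ε := by positivity
  have hεδ : 2 ^ d * (d * ε ^ 2) ≤ δ ^ 2 := by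
    rw [div_pow, Real.sq_sqrt (by positivity), ← mul_assoc, mul_div_assoc',
      div_le_iff₀ (by positivity)]
    nlinarith [sq_nonneg δ]
  obtain ⟨W, hW, hWc⟩ := exists_finiteDimensional_gridIndex hΩ hΩb hε
  refine ⟨W, hW, fun p hp => ?_⟩
  refine closure_minimal (t := {p : L2 Ω × L2Vec Ω | ‖p.1 - W.starProjection p.1‖ ≤ δ * ‖p.2‖})
    ?_ (isClosed_le (by fun_prop) (by fun_prop)) hp
  rintro ⟨u, G⟩ ⟨ψ, hψ, hu, hG⟩
  obtain ⟨c, hc⟩ := exists_gridIndex_approx hψ.smooth hε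
  obtain ⟨w, hwW, hw⟩ := hWc c
  have h1 : ‖u - W.starProjection u‖ ≤ ‖u - w‖ := by
    rw [Submodule.starProjection_minimal]
    exact ciInf_le ⟨0, by rintro _ ⟨x, rfl⟩; positivity⟩ (⟨w, hwW⟩ : W)
  refine h1.trans ?_
  have h2 : ‖u - w‖ₑ ^ 2 ≤ (ENNReal.ofReal δ * ‖G‖ₑ) ^ 2 := by
    rw [mul_pow, Lp.enorm_def, Lp.enorm_def, eLpNorm_two_sq, eLpNorm_two_sq]
    calc ∫⁻ x in Ω, ‖(u - w) x‖ₑ ^ 2 = ∫⁻ x in Ω, ‖ψ x - c (gridIndex ε x)‖ₑ ^ 2 := by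
          refine lintegral_congr_ae ?_
          filter_upwards [Lp.coeFn_sub u w, hu, hw] with x hx h1 h2
          simp only [hx, Pi.sub_apply, h1, h2]
      _ ≤ ∫⁻ x, ‖ψ x - c (gridIndex ε x)‖ₑ ^ 2 := setLIntegral_le_lintegral _ _
      _ ≤ _ := hc
      _ ≤ ENNReal.ofReal δ ^ 2 * ∫⁻ x, ‖gradient ψ x‖ₑ ^ 2 := by
          rw [← ENNReal.ofReal_pow hδ.le]
          gcongr
      _ = ENNReal.ofReal δ ^ 2 * ∫⁻ x in Ω, ‖gradient ψ x‖ₑ ^ 2 := by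
          congr 1
          refine (setLIntegral_eq_of_support_subset fun x hx => ?_).symm
          by_contra hxΩ
          simp [hψ.gradient_eq_zero_of_notMem hxΩ] at hx
      _ = ENNReal.ofReal δ ^ 2 * ∫⁻ x in Ω, ‖G x‖ₑ ^ 2 := by
          congr 1
          refine lintegral_congr_ae ?_
          filter_upwards [hG] with x hx
          simp only [hx]
  have h3 := (ENNReal.pow_le_pow_left_iff two_ne_zero).1 h2
  rw [← ofReal_norm, ← ofReal_norm, ← ENNReal.ofReal_mul hδ.le] at h3
  exact (ENNReal.ofReal_le_ofReal_iff (by positivity)).1 h3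

/-- **Rellich's theorem**: the embedding of `H¹₀(Ω)` in `L²(Ω)` is compact if `Ω` is bounded. It is
stated for an arbitrary normed space that maps continuously to the graph of the weak gradient. -/
lemma isCompactOperator_fst_of_mem_testClosure (hΩ : IsOpen Ω) (hΩb : Bornology.IsBounded Ω)
    {X : Type*} [NormedAddCommGroup X] [NormedSpace ℝ X] (N : X →L[ℝ] L2 Ω × L2Vec Ω)
    (hN : ∀ x, N x ∈ testClosure Ω) :
    IsCompactOperator (ContinuousLinearMap.fst ℝ (L2 Ω) (L2Vec Ω) ∘L N) := by
  set J := ContinuousLinearMap.fst ℝ (L2 Ω) (L2Vec Ω) ∘L N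
  refine isClosed_setOfPred_isCompactOperator.closure_subset
    (Metric.mem_closure_iff.2 fun δ hδ => ?_)
  obtain ⟨W, hW, hWJ⟩ := exists_finiteDimensional_approx hΩ hΩb
    (δ := δ / (2 * (‖N‖ + 1))) (by positivity)
  refine ⟨W.starProjection ∘L J, ?_, ?_⟩
  · have : ProperSpace W := FiniteDimensional.proper ℝ W
    exact (isCompactOperator_of_locallyCompactSpace_rng W.subtypeL).comp_clm
      (W.orthogonalProjectionOnto ∘L J)
  · rw [dist_eq_norm]
    refine (ContinuousLinearMap.opNorm_le_bound _ (half_pos hδ).le fun x => ?_).trans_lt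
      (half_lt_self hδ)
    calc ‖J x - W.starProjection (J x)‖ ≤ δ / (2 * (‖N‖ + 1)) * ‖(N x).2‖ := hWJ _ (hN x)
      _ ≤ δ / (2 * (‖N‖ + 1)) * ((‖N‖ + 1) * ‖x‖) := by
        gcongr
        exact (norm_snd_le _).trans ((N.le_opNorm x).trans (by gcongr; simp))
      _ = δ / 2 * ‖x‖ := by field_simp

/-! ### The weighted energy space -/

section Multiplication

variable {α F : Type*} {m : MeasurableSpace α} {ν : Measure α} [NormedAddCommGroup F]
  [NormedSpace ℝ F]

/-- Multiplication by an essentially bounded function, as an operator on `L²`. -/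
def mulL2 {f : α → ℝ} (hf : MemLp f ⊤ ν) : Lp F 2 ν →L[ℝ] Lp F 2 ν :=
  (ContinuousLinearMap.lsmul ℝ ℝ : ℝ →L[ℝ] F →L[ℝ] F).holderL ν ⊤ 2 2 hf.toLp

lemma coeFn_mulL2 {f : α → ℝ} (hf : MemLp f ⊤ ν) (u : Lp F 2 ν) :
    mulL2 hf u =ᵐ[ν] fun x => f x • u x := by
  filter_upwards [(ContinuousLinearMap.lsmul ℝ ℝ : ℝ →L[ℝ] F →L[ℝ] F).coeFn_holder (r := 2)
    hf.toLp u, hf.coeFn_toLp] with x hx h1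
  rw [mulL2, ContinuousLinearMap.holderL_apply_apply, hx, h1, ContinuousLinearMap.lsmul_apply]

lemma mulL2_mulL2_of_mul_eq_one {f g : α → ℝ} (hf : MemLp f ⊤ ν) (hg : MemLp g ⊤ ν)
    (h : ∀ᵐ x ∂ν, f x * g x = 1) (u : Lp F 2 ν) : mulL2 hf (mulL2 hg u) = u := by
  refine Lp.ext ?_
  filter_upwards [coeFn_mulL2 hf (mulL2 hg u), coeFn_mulL2 hg u, h] with x h1 h2 h3
  rw [h1, h2, smul_smul, h3, one_smul]

end Multiplication

lemma mem_testClosure_of_mem_H10 {w : L2 Ω} (hw : w ∈ H10 Ω) :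
    (w, weakGradient w) ∈ testClosure Ω := hw.2

lemma massForm_comm (κ : EuclideanSpace ℝ (Fin d) → ℝ) (v w : L2 Ω) :
    massForm κ v w = massForm κ w v := by
  simp only [massForm, mul_right_comm]

lemma energyForm_comm (κ : EuclideanSpace ℝ (Fin d) → ℝ) (v w : L2 Ω) :
    energyForm κ v w = energyForm κ w v := by
  unfold energyForm
  exact integral_congr_ae (.of_forall fun x => by simp only [real_inner_comm])

/-- Weights for which multiplication by `√κ` is an isomorphism of `L²(Ω)`. -/
structure IsWeight (Ω : Set (EuclideanSpace ℝ (Fin d))) (κ : EuclideanSpace ℝ (Fin d) → ℝ) :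
    Prop where
  memLp_sqrt : MemLp (fun x => √(κ x)) ⊤ (volume.restrict Ω)
  memLp_inv_sqrt : MemLp (fun x => (√(κ x))⁻¹) ⊤ (volume.restrict Ω)
  ae_pos : ∀ᵐ x ∂volume.restrict Ω, 0 < κ x

lemma IsWeight.of_bounds {κ : EuclideanSpace ℝ (Fin d) → ℝ}
    (hκ : MemLp κ ⊤ (volume.restrict Ω)) {c₀ : ℝ} (hc₀ : 0 < c₀)
    (hκ₀ : ∀ᵐ x ∂(volume.restrict Ω), c₀ ≤ κ x) : IsWeight Ω κ where
  memLp_sqrt := by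
    refine memLp_top_of_bound (Real.continuous_sqrt.comp_aestronglyMeasurable hκ.1)
      (√(eLpNorm κ ⊤ (volume.restrict Ω)).toReal) ?_
    filter_upwards [ae_le_eLpNormEssSup (f := κ) (μ := volume.restrict Ω)] with x hx
    rw [Real.norm_of_nonneg (Real.sqrt_nonneg _)]
    refine Real.sqrt_le_sqrt ((le_abs_self _).trans ?_)
    rw [← Real.norm_eq_abs, ← toReal_enorm]
    exact ENNReal.toReal_mono hκ.2.ne (by rwa [eLpNorm_exponent_top])
  memLp_inv_sqrt := by
    refine memLp_top_of_bound (Real.continuous_sqrt.comp_aestronglyMeasurable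
      hκ.1).aemeasurable.inv.aestronglyMeasurable (√c₀)⁻¹ ?_
    filter_upwards [hκ₀] with x hx
    rw [Real.norm_of_nonneg (by positivity)]
    gcongr
  ae_pos := hκ₀.mono fun x hx => hc₀.trans_le hx

namespace IsWeight

variable {κ : EuclideanSpace ℝ (Fin d) → ℝ} {F : Type*} [NormedAddCommGroup F]
  [InnerProductSpace ℝ F]

/-- Multiplication by `√κ` on `L²(Ω; F)`. It turns the inner product of `L²` into the inner product
with weight `κ`. -/
def mulSqrt (hκ : IsWeight Ω κ) :
    Lp F 2 (volume.restrict Ω) →L[ℝ] Lp F 2 (volume.restrict Ω) :=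
  mulL2 hκ.memLp_sqrt

/-- Division by `√κ` on `L²(Ω; F)`. -/
def divSqrt (hκ : IsWeight Ω κ) :
    Lp F 2 (volume.restrict Ω) →L[ℝ] Lp F 2 (volume.restrict Ω) :=
  mulL2 hκ.memLp_inv_sqrt

lemma mulSqrt_divSqrt (hκ : IsWeight Ω κ) (u : Lp F 2 (volume.restrict Ω)) :
    hκ.mulSqrt (hκ.divSqrt u) = u :=
  mulL2_mulL2_of_mul_eq_one _ _ (hκ.ae_pos.mono fun _ hx =>
    mul_inv_cancel₀ (Real.sqrt_pos.2 hx).ne') u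

lemma divSqrt_mulSqrt (hκ : IsWeight Ω κ) (u : Lp F 2 (volume.restrict Ω)) :
    hκ.divSqrt (hκ.mulSqrt u) = u :=
  mulL2_mulL2_of_mul_eq_one _ _ (hκ.ae_pos.mono fun _ hx =>
    inv_mul_cancel₀ (Real.sqrt_pos.2 hx).ne') u

lemma inner_mulSqrt (hκ : IsWeight Ω κ) (u v : Lp F 2 (volume.restrict Ω)) :
    inner ℝ (hκ.mulSqrt u) (hκ.mulSqrt v) = ∫ x in Ω, κ x * inner ℝ (u x) (v x) := by
  rw [L2.inner_def]
  refine integral_congr_ae ?_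
  filter_upwards [coeFn_mulL2 hκ.memLp_sqrt u, coeFn_mulL2 hκ.memLp_sqrt v, hκ.ae_pos]
    with x h1 h2 h3
  rw [mulSqrt, h1, h2, inner_smul_left, inner_smul_right, ← mul_assoc, conj_trivial,
    Real.mul_self_sqrt h3.le]

lemma inner_mulSqrt_eq_massForm (hκ : IsWeight Ω κ) (u v : L2 Ω) :
    inner ℝ (hκ.mulSqrt u) (hκ.mulSqrt v) = massForm κ u v := by
  rw [inner_mulSqrt, massForm]
  refine integral_congr_ae (.of_forall fun x => ?_)
  simp only [RCLike.inner_apply, conj_trivial]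
  ring

/-- The inverse of `(u, G) ↦ (√κ u, √κ G)`. -/
def unscale (hκ : IsWeight Ω κ) : WithLp 2 (L2 Ω × L2Vec Ω) →L[ℝ] L2 Ω × L2Vec Ω :=
  (hκ.divSqrt.prodMap hκ.divSqrt) ∘L
    (WithLp.prodContinuousLinearEquiv 2 ℝ (L2 Ω) (L2Vec Ω)).toContinuousLinearMap

/-- The space `H¹₀(Ω)` with the inner product `m + a`, realised as the closed subspace of the pairs
`(√κ u, √κ ∇u)` in the Hilbert sum of `L²(Ω)` and `L²(Ω; ℝᵈ)`. -/
def energySpace (hκ : IsWeight Ω κ) : Submodule ℝ (WithLp 2 (L2 Ω × L2Vec Ω)) :=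
  (testClosure Ω).comap (hκ.unscale : WithLp 2 (L2 Ω × L2Vec Ω) →ₗ[ℝ] L2 Ω × L2Vec Ω)

lemma isClosed_energySpace (hκ : IsWeight Ω κ) :
    IsClosed (hκ.energySpace : Set (WithLp 2 (L2 Ω × L2Vec Ω))) :=
  (Submodule.isClosed_topologicalClosure _).preimage hκ.unscale.continuous

instance (hκ : IsWeight Ω κ) : CompleteSpace hκ.energySpace :=
  hκ.isClosed_energySpace.completeSpace_coe

/-- The element of the energy space given by an element of the graph of the weak gradient. -/
def scale (hκ : IsWeight Ω κ) (p : L2 Ω × L2Vec Ω) (hp : p ∈ testClosure Ω) : hκ.energySpace :=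
  ⟨WithLp.toLp 2 (hκ.mulSqrt p.1, hκ.mulSqrt p.2), by
    change (hκ.divSqrt (hκ.mulSqrt p.1), hκ.divSqrt (hκ.mulSqrt p.2)) ∈ testClosure Ω
    rwa [hκ.divSqrt_mulSqrt, hκ.divSqrt_mulSqrt]⟩

lemma unscale_mem (hκ : IsWeight Ω κ) (v : hκ.energySpace) : hκ.unscale v ∈ testClosure Ω := v.2

lemma scale_unscale (hκ : IsWeight Ω κ) (v : hκ.energySpace) :
    hκ.scale (hκ.unscale v) (hκ.unscale_mem v) = v := by
  refine Subtype.ext ?_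
  change WithLp.toLp 2 (hκ.mulSqrt (hκ.divSqrt v.1.1.1), hκ.mulSqrt (hκ.divSqrt v.1.1.2)) = v.1
  rw [hκ.mulSqrt_divSqrt, hκ.mulSqrt_divSqrt]

/-- The inner product of the energy space is `m + a`. -/
lemma inner_scale (hκ : IsWeight Ω κ) (hΩ : IsOpen Ω) {p q : L2 Ω × L2Vec Ω}
    (hp : p ∈ testClosure Ω) (hq : q ∈ testClosure Ω) :
    inner ℝ (hκ.scale p hp) (hκ.scale q hq) = massForm κ p.1 q.1 + energyForm κ p.1 q.1 := by
  rw [energyForm, weakGradient_eq_of_mem hΩ hp, weakGradient_eq_of_mem hΩ hq,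
    ← hκ.inner_mulSqrt_eq_massForm, ← hκ.inner_mulSqrt]
  rfl

/-- The embedding of the energy space in `L²(Ω)`, which maps `(√κ u, √κ ∇u)` to `√κ u`. -/
def embed (hκ : IsWeight Ω κ) : hκ.energySpace →L[ℝ] L2 Ω :=
  WithLp.fstL 2 ℝ (L2 Ω) (L2Vec Ω) ∘L hκ.energySpace.subtypeL

lemma embed_scale (hκ : IsWeight Ω κ) {p : L2 Ω × L2Vec Ω} (hp : p ∈ testClosure Ω) :
    hκ.embed (hκ.scale p hp) = hκ.mulSqrt p.1 := rfl

lemma embed_eq (hκ : IsWeight Ω κ) (v : hκ.energySpace) :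
    hκ.embed v = hκ.mulSqrt (hκ.unscale v).1 :=
  (hκ.mulSqrt_divSqrt v.1.1.1).symm

lemma isCompactOperator_embed (hκ : IsWeight Ω κ) (hΩ : IsOpen Ω)
    (hΩb : Bornology.IsBounded Ω) : IsCompactOperator hκ.embed := by
  have h := (isCompactOperator_fst_of_mem_testClosure hΩ hΩb
    (hκ.unscale ∘L hκ.energySpace.subtypeL) hκ.unscale_mem).clm_comp (hκ.mulSqrt (F := ℝ))
  rwa [show ⇑hκ.embed = _ from funext hκ.embed_eq]

/-- The adjoint of the embedding is injective, since test functions are dense in `L²(Ω)`. -/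
lemma eq_zero_of_adjoint_embed_eq_zero (hκ : IsWeight Ω κ) (hΩ : IsOpen Ω) {f : L2 Ω}
    (hf : ContinuousLinearMap.adjoint hκ.embed f = 0) : f = 0 := by
  have h : ∀ᵐ x, x ∈ Ω → hκ.mulSqrt f x = 0 := by
    refine hΩ.ae_eq_zero_of_integral_contDiff_smul_eq_zero
      (locallyIntegrableOn_of_locallyIntegrable_restrict
        ((Lp.memLp _).locallyIntegrable (by norm_num))) fun ψ h1 h2 h3 => ?_
    have hψ : IsTestFunction Ω ψ := ⟨h1, h2, h3⟩
    have e : inner ℝ f (hκ.embed (hκ.scale _ hψ.toLp_mem)) = 0 := by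
      rw [← ContinuousLinearMap.adjoint_inner_left, hf, inner_zero_left]
    rw [embed_scale, L2.inner_def] at e
    rw [← setIntegral_eq_integral_of_forall_compl_eq_zero (s := Ω)
      (fun x hx => by simp [hψ.eq_zero_of_notMem hx]), ← e]
    refine integral_congr_ae ?_
    filter_upwards [coeFn_mulL2 hκ.memLp_sqrt f,
      coeFn_mulL2 hκ.memLp_sqrt ((hψ.memLp 2).toLp ψ), (hψ.memLp 2).coeFn_toLp] with x h1 h2 h3
    simp only [mulSqrt, h1, h2, h3, smul_eq_mul, RCLike.inner_apply, conj_trivial]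
    ring
  rw [← ae_restrict_iff' hΩ.measurableSet] at h
  have h0 : hκ.mulSqrt f = 0 := Lp.ext (EventuallyEq.trans h (Lp.coeFn_zero _ _ _).symm)
  rw [← hκ.divSqrt_mulSqrt f, h0, map_zero]

/-- If `J J* f = t f` with `t ≠ 0`, then `⟨J* f, z⟩ = ⟨f, J z⟩ = t⁻¹ ⟨J J* f, J z⟩` for all `z` in
the energy space, so the function underlying `J* f` solves the eigenvalue problem for `t⁻¹ - 1`. -/
lemma solvesEigenproblem_of_embed_adjoint (hκ : IsWeight Ω κ) (hΩ : IsOpen Ω) {f : L2 Ω} {t : ℝ}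
    (ht : t ≠ 0) (hf : hκ.embed (ContinuousLinearMap.adjoint hκ.embed f) = t • f) :
    SolvesEigenproblem κ (t⁻¹ - 1)
      (hκ.unscale (ContinuousLinearMap.adjoint hκ.embed f : hκ.energySpace)).1 := by
  have hinner (z) : inner ℝ (ContinuousLinearMap.adjoint hκ.embed f) z =
      inner ℝ f (hκ.embed z) := ContinuousLinearMap.adjoint_inner_left _ _ _
  generalize ContinuousLinearMap.adjoint hκ.embed f = v at hf hinner
  have hp := hκ.unscale_mem v
  rw [hκ.embed_eq] at hf
  refine ⟨mem_H10_of_mem hΩ hp, fun z hz => ?_⟩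
  have hq := mem_testClosure_of_mem_H10 hz
  have h1 := hκ.inner_scale hΩ hp hq
  rw [hκ.scale_unscale, hinner, hκ.embed_scale hq] at h1
  have h2 : t⁻¹ * massForm κ (hκ.unscale v).1 z = inner ℝ f (hκ.mulSqrt z) := by
    rw [← hκ.inner_mulSqrt_eq_massForm, hf, real_inner_smul_left, inv_mul_cancel_left₀ ht]
  linear_combination -h1 - h2

end IsWeight

/-! ### Completeness of the eigenfunctions -/

namespace IsDirichletEigensystem

variable {κ : EuclideanSpace ℝ (Fin d) → ℝ} {μ : ℕ → ℝ} {φ : ℕ → L2 Ω}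

lemma orthonormal_mulSqrt (hφ : IsDirichletEigensystem κ μ φ) (hκ : IsWeight Ω κ) :
    Orthonormal ℝ fun l => hκ.mulSqrt (φ l) := by
  rw [orthonormal_iff_ite]
  intro k l
  rw [hκ.inner_mulSqrt_eq_massForm, hφ.orthonormal]

/-- The functions `√κ φₗ` are complete in `L²(Ω)`. With the embedding `J` of the energy space, the
operator `J J*` on `L²(Ω)` is compact, self-adjoint and injective, so its eigenvectors with nonzero
eigenvalues are complete, and these are combinations of the `√κ φₗ`. -/
lemma orthogonal_span_mulSqrt_eq_bot (hφ : IsDirichletEigensystem κ μ φ) (hκ : IsWeight Ω κ)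
    (hΩ : IsOpen Ω) (hΩb : Bornology.IsBounded Ω) :
    (Submodule.span ℝ (Set.range fun l => hκ.mulSqrt (φ l)))ᗮ = ⊥ := by
  set J := hκ.embed
  set T : L2 Ω →L[ℝ] L2 Ω := J ∘L ContinuousLinearMap.adjoint J
  have hTc : IsCompactOperator T :=
    (hκ.isCompactOperator_embed hΩ hΩb).comp_clm (ContinuousLinearMap.adjoint J)
  have hTs : (T : L2 Ω →ₗ[ℝ] L2 Ω).IsSymmetric := fun x y => by
    change inner ℝ (J (ContinuousLinearMap.adjoint J x)) y =
      inner ℝ x (J (ContinuousLinearMap.adjoint J y))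
    rw [← ContinuousLinearMap.adjoint_inner_right, ContinuousLinearMap.adjoint_inner_left]
  have hspec := ContinuousLinearMap.orthogonalComplement_iSup_eigenspaces_eq_bot hTc hTs
  rw [eq_bot_iff, ← hspec]
  refine (Submodule.le_orthogonal_orthogonal _).trans
    (Submodule.orthogonal_le (iSup_le fun t f hf => ?_))
  have hf' : J (ContinuousLinearMap.adjoint J f) = t • f := Module.End.mem_eigenspace_iff.1 hf
  rcases eq_or_ne t 0 with rfl | ht
  · -- The kernel of `J J*` is the kernel of `J*`.
    have h0 : ContinuousLinearMap.adjoint J f = 0 := by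
      rw [← inner_self_eq_zero (𝕜 := ℝ), ContinuousLinearMap.adjoint_inner_left, hf', zero_smul,
        inner_zero_right]
    rw [hκ.eq_zero_of_adjoint_embed_eq_zero hΩ h0]
    exact Submodule.zero_mem _
  · have hsol := hκ.solvesEigenproblem_of_embed_adjoint hΩ ht hf'
    have hw := hκ.embed_eq (ContinuousLinearMap.adjoint J f)
    have hspan := Submodule.mem_map_of_mem (f := (hκ.mulSqrt : L2 Ω →L[ℝ] L2 Ω).toLinearMap)
      (hφ.exhaustive _ _ hsol)
    rw [Submodule.map_span, ← Set.image_comp] at hspan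
    have hmem : t • f ∈ Submodule.span ℝ (Set.range fun l => hκ.mulSqrt (φ l)) := by
      rw [← hf', hw]
      refine Submodule.span_mono ?_ hspan
      rintro _ ⟨l, -, rfl⟩
      exact ⟨l, rfl⟩
    exact Submodule.le_orthogonal_orthogonal _ ((Submodule.smul_mem_iff _ ht).1 hmem)

/-- The Hilbert basis `√κ φₗ` of `L²(Ω)`. -/
def basis (hφ : IsDirichletEigensystem κ μ φ) (hκ : IsWeight Ω κ) (hΩ : IsOpen Ω)
    (hΩb : Bornology.IsBounded Ω) : HilbertBasis ℕ ℝ (L2 Ω) :=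
  HilbertBasis.mkOfOrthogonalEqBot (hφ.orthonormal_mulSqrt hκ)
    (hφ.orthogonal_span_mulSqrt_eq_bot hκ hΩ hΩb)

lemma basis_apply (hφ : IsDirichletEigensystem κ μ φ) (hκ : IsWeight Ω κ) (hΩ : IsOpen Ω)
    (hΩb : Bornology.IsBounded Ω) (l : ℕ) : hφ.basis hκ hΩ hΩb l = hκ.mulSqrt (φ l) :=
  congrFun (HilbertBasis.coe_mkOfOrthogonalEqBot _ _) l

lemma basis_repr_mulSqrt (hφ : IsDirichletEigensystem κ μ φ) (hκ : IsWeight Ω κ) (hΩ : IsOpen Ω)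
    (hΩb : Bornology.IsBounded Ω) (v : L2 Ω) (l : ℕ) :
    (hφ.basis hκ hΩ hΩb).repr (hκ.mulSqrt v) l = massForm κ v (φ l) := by
  rw [HilbertBasis.repr_apply_apply, basis_apply, real_inner_comm, hκ.inner_mulSqrt_eq_massForm]

/-- An element of `L²(Ω)` is determined by its coefficients with respect to the `φₗ`. -/
lemma ext_massForm (hφ : IsDirichletEigensystem κ μ φ) (hκ : IsWeight Ω κ) (hΩ : IsOpen Ω)
    (hΩb : Bornology.IsBounded Ω) {v w : L2 Ω}
    (h : ∀ l, massForm κ v (φ l) = massForm κ w (φ l)) : v = w := by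
  have : hκ.mulSqrt v = hκ.mulSqrt w := by
    refine (hφ.basis hκ hΩ hΩb).repr.injective (lp.ext (funext fun l => ?_))
    rw [basis_repr_mulSqrt, basis_repr_mulSqrt, h]
  rw [← hκ.divSqrt_mulSqrt v, this, hκ.divSqrt_mulSqrt]

/-- By the Riesz-Fischer theorem, `∑ₗ aₗ φₗ` converges in `L²(Ω)` for square-summable `a`, and its
sum has the coefficients `a`. -/
lemma exists_hasSum (hφ : IsDirichletEigensystem κ μ φ) (hκ : IsWeight Ω κ) (hΩ : IsOpen Ω)
    (hΩb : Bornology.IsBounded Ω) {a : ℕ → ℝ} (ha : Summable fun l => a l ^ 2) :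
    ∃ f : L2 Ω, HasSum (fun l => a l • φ l) f ∧ (∀ l, massForm κ f (φ l) = a l) ∧
      massForm κ f f = ∑' l, a l ^ 2 := by
  set b := hφ.basis hκ hΩ hΩb
  have hmem : Memℓp a 2 := memℓp_gen (by simpa using ha)
  set A : lp (fun _ : ℕ => ℝ) 2 := ⟨a, hmem⟩
  set f := hκ.divSqrt (b.repr.symm A)
  have hf : hκ.mulSqrt f = b.repr.symm A := hκ.mulSqrt_divSqrt _
  have hcoef (l) : massForm κ f (φ l) = a l := by
    rw [← hφ.basis_repr_mulSqrt hκ hΩ hΩb, hf, LinearIsometryEquiv.apply_symm_apply]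
  refine ⟨f, ?_, hcoef, ?_⟩
  · have h := (b.hasSum_repr_symm A).mapL (hκ.divSqrt (F := ℝ))
    convert h using 2 with l
    rw [map_smul, hφ.basis_apply, hκ.divSqrt_mulSqrt]
  · rw [← hκ.inner_mulSqrt_eq_massForm, ← b.tsum_inner_mul_inner]
    refine tsum_congr fun l => ?_
    rw [hφ.basis_apply, hκ.inner_mulSqrt_eq_massForm, hκ.inner_mulSqrt_eq_massForm,
      massForm_comm κ (φ l), hcoef, sq]

end IsDirichletEigensystem

/-! ### Weak solutions and their divergence -/

namespace IsDirichletEigensystem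

variable {κ : EuclideanSpace ℝ (Fin d) → ℝ} {μ : ℕ → ℝ} {φ : ℕ → L2 Ω}

lemma eigenvalue_nonneg (hφ : IsDirichletEigensystem κ μ φ) (hκ : IsWeight Ω κ) (l : ℕ) :
    0 ≤ μ l := by
  have h := (hφ.eigen l).2 _ (hφ.eigen l).1
  rw [hφ.orthonormal, if_pos rfl, mul_one] at h
  rw [← h]
  refine integral_nonneg_of_ae (hκ.ae_pos.mono fun x hx => ?_)
  exact mul_nonneg hx.le real_inner_self_nonneg

/-- If `f = ∑ₗ μₗ m(u, φₗ) φₗ`, then `u` is the weak solution in `H¹₀(Ω)` of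
`-div(κ∇u) = κ f`. The weak solution `w` of `-div(κ∇w) + κ w = κ (f + u)` exists by the Riesz
representation theorem. Testing with `φₗ` shows that its coefficients are those of `u`. -/
lemma mem_H10_and_energyForm_eq (hφ : IsDirichletEigensystem κ μ φ) (hκ : IsWeight Ω κ)
    (hΩ : IsOpen Ω) (hΩb : Bornology.IsBounded Ω) {u f : L2 Ω}
    (hf : ∀ l, massForm κ f (φ l) = μ l * massForm κ u (φ l)) :
    u ∈ H10 Ω ∧ ∀ z ∈ H10 Ω, energyForm κ u z = massForm κ f z := by
  have hinner (z) : inner ℝ (ContinuousLinearMap.adjoint hκ.embed (hκ.mulSqrt (f + u))) z =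
      inner ℝ (hκ.mulSqrt (f + u)) (hκ.embed z) := ContinuousLinearMap.adjoint_inner_left _ _ _
  generalize ContinuousLinearMap.adjoint hκ.embed (hκ.mulSqrt (f + u)) = v at hinner
  have hp := hκ.unscale_mem v
  have hadd (z) : massForm κ (f + u) z = massForm κ f z + massForm κ u z := by
    simp only [← hκ.inner_mulSqrt_eq_massForm, map_add, inner_add_left]
  have hv {z : L2 Ω} (hz : z ∈ H10 Ω) : massForm κ (hκ.unscale v).1 z +
      energyForm κ (hκ.unscale v).1 z = massForm κ f z + massForm κ u z := by
    have hq := mem_testClosure_of_mem_H10 hz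
    rw [← hκ.inner_scale hΩ hp hq, hκ.scale_unscale, hinner, hκ.embed_scale hq,
      hκ.inner_mulSqrt_eq_massForm, hadd]
  have hu : (hκ.unscale v).1 = u := by
    refine hφ.ext_massForm hκ hΩ hΩb fun l => ?_
    have h1 := hv (hφ.eigen l).1
    have h2 := (hφ.eigen l).2 _ (mem_H10_of_mem hΩ hp)
    rw [energyForm_comm, h2, massForm_comm κ (φ l), hf] at h1
    have h0 := hφ.eigenvalue_nonneg hκ l
    exact mul_left_cancel₀ (by positivity : (1 + μ l) ≠ 0) (by linear_combination h1)
  rw [hu] at hv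
  exact ⟨hu ▸ mem_H10_of_mem hΩ hp, fun z hz => by linear_combination hv hz⟩

end IsDirichletEigensystem

/-- A weak solution of `-div(κ∇u) = κ f` has the weak divergence `div(κ∇u) = -κ f`. -/
lemma hasWeakDivergence_of_energyForm_eq {κ : EuclideanSpace ℝ (Fin d) → ℝ} (hΩ : IsOpen Ω)
    (hκ : MemLp κ ⊤ (volume.restrict Ω)) {u f : L2 Ω}
    (h : ∀ z ∈ H10 Ω, energyForm κ u z = massForm κ f z) :
    HasWeakDivergence Ω (fun x => κ x • weakGradient u x) (fun x => -(κ x * f x)) where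
  locallyIntegrable_field := locallyIntegrableOn_of_locallyIntegrable_restrict
    (((Lp.memLp (weakGradient u)).smul (r := 2) hκ).locallyIntegrable (by norm_num))
  locallyIntegrable_div := locallyIntegrableOn_of_locallyIntegrable_restrict
    ((((Lp.memLp f).smul (r := 2) hκ).neg).locallyIntegrable (by norm_num))
  integral_eq ψ hψ := by
    have hz := h _ (mem_H10_of_mem hΩ hψ.toLp_mem)
    rw [energyForm, massForm, weakGradient_eq_of_mem hΩ hψ.toLp_mem] at hz
    have h1 : ∫ x in Ω, inner ℝ (κ x • weakGradient u x) (gradient ψ x) =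
        ∫ x in Ω, κ x * inner ℝ (weakGradient u x)
          ((hψ.memLp_gradient 2).toLp (gradient ψ) x) := by
      refine integral_congr_ae ?_
      filter_upwards [(hψ.memLp_gradient 2).coeFn_toLp] with x hx
      rw [hx, real_inner_smul_left]
    have h2 : ∫ x in Ω, κ x * f x * (hψ.memLp 2).toLp ψ x = ∫ x in Ω, κ x * f x * ψ x := by
      refine integral_congr_ae ?_
      filter_upwards [(hψ.memLp 2).coeFn_toLp] with x hx
      rw [hx]
    rw [h1, hz, h2, ← integral_neg]
    simp only [neg_mul]

end WeightedDirichlet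

end

open WeightedDirichlet
theorem mainTheorem4 {d : ℕ} {Ω : Set (EuclideanSpace ℝ (Fin d))}
    (hΩ : IsOpen Ω) (hΩb : Bornology.IsBounded Ω)
    {κ : EuclideanSpace ℝ (Fin d) → ℝ} (hκ : MemLp κ ⊤ (volume.restrict Ω))
    {c₀ : ℝ} (hc₀ : 0 < c₀) (hκ₀ : ∀ᵐ x ∂(volume.restrict Ω), c₀ ≤ κ x)
    {μ : ℕ → ℝ} {φ : ℕ → L2 Ω} (hφ : IsDirichletEigensystem κ μ φ)
    (u : L2 Ω) (hu : eigenNorm κ μ φ 2 u < ⊤) :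
    Summable (fun l => (μ l * massForm κ u (φ l)) • φ l) ∧
    u ∈ H10 Ω ∧
    ∃ g : EuclideanSpace ℝ (Fin d) → ℝ,
      HasWeakDivergence Ω (fun x => κ x • weakGradient u x) g ∧
      MemLp (fun x => (κ x)⁻¹ * g x) 2 (volume.restrict Ω) ∧
      eigenOperator κ μ φ u =ᵐ[volume.restrict Ω] (fun x => -((κ x)⁻¹ * g x)) ∧
      eigenNorm κ μ φ 2 u ^ 2 =
        ENNReal.ofReal (massForm κ (eigenOperator κ μ φ u) (eigenOperator κ μ φ u)) ∧
      massForm κ (eigenOperator κ μ φ u) (eigenOperator κ μ φ u) =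
        ∫ x in Ω, (κ x)⁻¹ * |g x| ^ 2 := by
  have hw : IsWeight Ω κ := .of_bounds hκ hc₀ hκ₀
  have hterm (l : ℕ) : μ l ^ (2 : ℝ) * massForm κ u (φ l) ^ 2 =
      (μ l * massForm κ u (φ l)) ^ 2 := by
    rw [Real.rpow_two, mul_pow]
  have hnorm : eigenNorm κ μ φ 2 u ^ 2 =
      ∑' l, ENNReal.ofReal ((μ l * massForm κ u (φ l)) ^ 2) := by
    simp only [eigenNorm, hterm]
    rw [← ENNReal.rpow_two, ← ENNReal.rpow_mul]
    norm_num
  have hsq : Summable fun l => (μ l * massForm κ u (φ l)) ^ 2 := by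
    have hfin := hnorm ▸ (ENNReal.pow_lt_top hu (n := 2)).ne
    exact (ENNReal.summable_toReal hfin).congr fun l => ENNReal.toReal_ofReal (sq_nonneg _)
  obtain ⟨f, hsum, hcoef, hmass⟩ := hφ.exists_hasSum hw hΩ hΩb hsq
  obtain ⟨huH, hweak⟩ := hφ.mem_H10_and_energyForm_eq hw hΩ hΩb hcoef
  have hop : eigenOperator κ μ φ u = f := hsum.tsum_eq
  have hdiv : f =ᵐ[volume.restrict Ω] fun x => -((κ x)⁻¹ * -(κ x * f x)) :=
    hw.ae_pos.mono fun x hx => by field_simp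
  rw [hop]
  refine ⟨hsum.summable, huH, fun x => -(κ x * f x),
    hasWeakDivergence_of_energyForm_eq hΩ hκ hweak, ?_, hdiv, ?_, ?_⟩
  · refine (memLp_congr_ae ?_).2 (Lp.memLp f).neg
    filter_upwards [hdiv] with x hx
    rw [Pi.neg_apply, ← neg_eq_iff_eq_neg.2 hx]
  · rw [hnorm, hmass, ENNReal.ofReal_tsum_of_nonneg (fun l => sq_nonneg _) hsq]
  · refine integral_congr_ae (hw.ae_pos.mono fun x hx => ?_)
    simp only [sq_abs]
    field_simp
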